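/- Let $k$ be a perfect field of characteristic $p>0$, let $S=k[x_1,\dots,x_n]$, and let $e\ge 1$. Write $F^e_*S$ for $S$ regarded as an $S$-module through the $e$-fold Frobenius, write $F^e_*r$ for the element of $F^e_*S$ given by $r \in S$, and let $\Phi_S:F^e_*S\to S$ be the $S$-linear map that sends the basis element $F^e_*(x_1\cdots x_n)^{p^e-1}$ to $1$ and every other basis element $F^e_*(x_1^{\lambda_1}\cdots x_n^{\lambda_n})$, $0\le\lambda_i\le p^e-1$, to $0$. Let $\phi:F^e_*S\to S$ be a surjective $S$-linear map and let $z\in S$ be such that $\phi(F^e_*\,\cdot\,)=\Phi_S(F^e_*z\,\cdot\,)$. An ideal $\mathfrak a\subseteq S$ is called $\phi$-compatible if $\phi(F^e_*\mathfrak a)\subseteq\mathfrak a$. Write $\phi^t:F^{te}_*S\to S$ for the $t$-fold composition of $\phi$ with itself, and $Q^{[p^e]}$ for the ideal generated by the $p^e$-th powers of the elements of $Q$. For a prime $\phi$-compatible ideal $Q$, consider the following step. (1) Choose an ideal $J\subseteq S$ such that $\operatorname{Spec}(S/Q)\setminus V(J)$ is a regular non-empty scheme. (2) Let $B=\bigl((\langle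 z\rangle+Q^{[p^e]}):(Q^{[p^e]}:Q)\bigr)$. (3) Find the first $t \ge 0$ with $\phi^t(F^{te}_*(JB+Q))=\phi^{t+1}(F^{(t+1)e}_*(JB+Q))$, and call this ideal $C$. (4) Let $Q_1,\dots,Q_m$ be the minimal primes of $C$, add them to the list, and repeat the procedure with each $Q_i$ in place of $Q$. Then: (a) For every prime $\phi$-compatible ideal $Q$ and every $J$ as in (1), the integer $t$ in (3) exists, and every prime $\phi$-compatible ideal $P$ that properly contains $Q$ contains $Q_i$ for some $1\le i\le m$. (b) Consequently the recursive algorithm is correct: if an ideal $J=J(Q)$ as in (1) is chosen for every prime $\phi$-compatible ideal $Q$, then, started at any prime $\phi$-compatible ideal $Q$, the recursion terminates, and the ideals that it lists are finitely many and are exactly the prime $\phi$-compatible ideals of $S$ that properly contain $Q$. -/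

import Mathlib

namespace FrobeniusAlg

universe u

section General

/-- The `R`-module `F^e_* R`: the additive group of `R`, on which `r` acts as multiplication
by `r ^ (p ^ e)`. -/
def FPush (R : Type u) (_p _e : ℕ) : Type u := R

instance FPush.addCommGroup (R : Type u) [CommRing R] (p e : ℕ) : AddCommGroup (FPush R p e) :=
  inferInstanceAs (AddCommGroup R)

noncomputable instance FPush.module (R : Type u) [CommRing R] (p : ℕ) [ExpChar R p] (e : ℕ) :
    Module R (FPush R p e) :=
  Module.compHom R (iterateFrobenius R p e)

/-- The bijection `R → F^e_* R`, `r ↦ F^e_* r`. -/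
def toF (R : Type u) [CommRing R] (p e : ℕ) : R ≃+ FPush R p e := AddEquiv.refl R

variable {R : Type u} [CommRing R] {p : ℕ} [ExpChar R p] {e : ℕ}

theorem smul_toF (r x : R) : r • toF R p e x = toF R p e (r ^ (p ^ e) * x) := rfl

/-- `F^e_* a` as an `R`-submodule of `F^e_* R`, for an ideal `a` of `R`. -/
def pushIdeal (p : ℕ) [ExpChar R p] (e : ℕ) (a : Ideal R) : Submodule R (FPush R p e) where
  carrier := {y | (toF R p e).symm y ∈ a}
  add_mem' hx hy := a.add_mem hx hy
  zero_mem' := by simp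
  smul_mem' r y hy := a.mul_mem_left (r ^ (p ^ e)) hy

/-- The ideal `φ(F^e_* a)`. -/
noncomputable def imageIdeal (φ : FPush R p e →ₗ[R] R) (a : Ideal R) : Ideal R := (pushIdeal p e a).map φ

/-- The ideal `a` is `φ`-compatible: `φ(F^e_* a) ⊆ a`. -/
def IsCompatible (φ : FPush R p e →ₗ[R] R) (a : Ideal R) : Prop := imageIdeal φ a ≤ a

theorem iterate_pow_mul (φ : FPush R p e →ₗ[R] R) (r : R) (t : ℕ) : ∀ x : R,
    (fun y => φ (toF R p e y))^[t] (r ^ (p ^ (t * e)) * x) =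
      r * (fun y => φ (toF R p e y))^[t] x := by
  induction t with
  | zero => intro x; simp
  | succ t ih =>
    intro x
    have h : φ (toF R p e (r ^ (p ^ ((t + 1) * e)) * x)) =
        r ^ (p ^ (t * e)) * φ (toF R p e x) := by
      rw [add_mul, one_mul, pow_add, pow_mul, ← smul_toF, map_smul, smul_eq_mul]
    simp only [Function.iterate_succ, Function.comp_apply]
    rw [h, ih]

theorem iterate_map_add (φ : FPush R p e →ₗ[R] R) (t : ℕ) : ∀ x y : R,
    (fun y => φ (toF R p e y))^[t] (x + y) =
      (fun y => φ (toF R p e y))^[t] x + (fun y => φ (toF R p e y))^[t] y := by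
  induction t with
  | zero => intro x y; simp
  | succ t ih =>
    intro x y
    simp only [Function.iterate_succ, Function.comp_apply, map_add, ih]

/-- The `t`-fold composition `φ^t : F^{te}_* R → R`. -/
noncomputable def powMap (φ : FPush R p e →ₗ[R] R) (t : ℕ) : FPush R p (t * e) →ₗ[R] R where
  toFun y := (fun x => φ (toF R p e x))^[t] ((toF R p (t * e)).symm y)
  map_add' x y := by rw [map_add, iterate_map_add]
  map_smul' r y := iterate_pow_mul φ r t _

/-- `t` is the first index with `φ^t(F^{te}_* a) = φ^{t+1}(F^{(t+1)e}_* a)`. -/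
def IsFirstStable (φ : FPush R p e →ₗ[R] R) (a : Ideal R) (t : ℕ) : Prop :=
  IsLeast {s : ℕ | imageIdeal (powMap φ s) a = imageIdeal (powMap φ (s + 1)) a} t

/-- The Frobenius power `Q^{[p^e]}`, generated by the `p^e`-th powers of the elements of `Q`. -/
def frobPower (p : ℕ) [ExpChar R p] (e : ℕ) (Q : Ideal R) : Ideal R :=
  Q.map (iterateFrobenius R p e)

/-- The ideal `B = (⟨z⟩ + Q^{[p^e]}) : (Q^{[p^e]} : Q)`. -/
def idealB (p : ℕ) [ExpChar R p] (e : ℕ) (z : R) (Q : Ideal R) : Ideal R :=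
  (Ideal.span {z} ⊔ frobPower p e Q).colon
    (((frobPower p e Q).colon (Q : Set R) : Ideal R) : Set R)

/-- `Spec (R/Q) \ V(J)` is a regular non-empty scheme. -/
def HasRegularNonemptyComplement (Q J : Ideal R) : Prop :=
  (∃ x : PrimeSpectrum (R ⧸ Q),
    x ∉ PrimeSpectrum.zeroLocus ((J.map (Ideal.Quotient.mk Q) : Ideal (R ⧸ Q)) : Set (R ⧸ Q))) ∧
  ∀ x : PrimeSpectrum (R ⧸ Q),
    x ∉ PrimeSpectrum.zeroLocus ((J.map (Ideal.Quotient.mk Q) : Ideal (R ⧸ Q)) : Set (R ⧸ Q)) →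
      IsRegularLocalRing (Localization.AtPrime x.asIdeal)

/-- The ideal `J B + Q` from which the chain `φ^t(F^{te}_* (J B + Q))` starts. -/
def startIdeal (p : ℕ) [ExpChar R p] (e : ℕ) (z : R) (Q J : Ideal R) : Ideal R :=
  J * idealB p e z Q ⊔ Q

/-- `AlgorithmLists φ z J Q L`: the recursive algorithm, run on the input `Q` with the ideal `J Q'`
chosen in the first step at every prime `Q'` that is visited, terminates, and the set of ideals
that it lists is `L`. One pass at `Q` finds the first `t` at which the chain
`φ^t(F^{te}_* (J B + Q))` is stationary, lists the minimal primes of the ideal `C` reached there,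
and then runs the algorithm on each of them. (A derivation is a well-founded tree, so it exists
only if the recursion ends.) -/
inductive AlgorithmLists (φ : FPush R p e →ₗ[R] R) (z : R) (J : Ideal R → Ideal R) :
    Ideal R → Set (Ideal R) → Prop
  | pass (Q : Ideal R) (t : ℕ) (C : Ideal R)
      (ht : IsFirstStable φ (startIdeal p e z Q (J Q)) t)
      (hC : C = imageIdeal (powMap φ t) (startIdeal p e z Q (J Q)))
      (L : Ideal R → Set (Ideal R))
      (hL : ∀ Q' ∈ C.minimalPrimes, AlgorithmLists φ z J Q' (L Q')) :
      AlgorithmLists φ z J Q (C.minimalPrimes ∪ ⋃ Q' ∈ C.minimalPrimes, L Q')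

end General

section Polynomial

variable {k : Type u} [Field k] {p : ℕ} [ExpChar k p] [PerfectRing k p] {n : ℕ}

/-- The exponent vector `p^e m + (p^e - 1, …, p^e - 1)`. -/
noncomputable def traceExponent (p e : ℕ) (m : Fin n →₀ ℕ) : Fin n →₀ ℕ :=
  Finsupp.equivFunOnFinite.symm fun i => p ^ e * m i + (p ^ e - 1)

theorem traceExponent_apply (p e : ℕ) (m : Fin n →₀ ℕ) (i : Fin n) :
    traceExponent p e m i = p ^ e * m i + (p ^ e - 1) := rfl

theorem traceExponent_injective {p e : ℕ} (h : 0 < p ^ e) :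
    Function.Injective (traceExponent p e : (Fin n →₀ ℕ) → (Fin n →₀ ℕ)) := by
  intro a b hab
  ext i
  have h1 := DFunLike.congr_fun hab i
  rw [traceExponent_apply, traceExponent_apply] at h1
  exact Nat.eq_of_mul_eq_mul_left h (Nat.add_right_cancel h1)

/-- The polynomial whose coefficient at `x^m` is the `p^e`-th root of the coefficient of `f` at
`x^(p^e m + (p^e - 1, …, p^e - 1))`. -/
noncomputable def traceFun (p : ℕ) [ExpChar k p] [PerfectRing k p] (e : ℕ)
    (f : MvPolynomial (Fin n) k) : MvPolynomial (Fin n) k :=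
  AddMonoidAlgebra.ofCoeff
    ((Finsupp.comapDomain (traceExponent p e) (AddMonoidAlgebra.coeff f)
      (traceExponent_injective (expChar_pow_pos k p e)).injOn).mapRange
        (iterateFrobeniusEquiv k p e).symm (map_zero _))

theorem coeff_traceFun (e : ℕ) (f : MvPolynomial (Fin n) k) (m : Fin n →₀ ℕ) :
    MvPolynomial.coeff m (traceFun p e f) =
      (iterateFrobeniusEquiv k p e).symm (MvPolynomial.coeff (traceExponent p e m) f) := rfl

theorem traceFun_add (e : ℕ) (f g : MvPolynomial (Fin n) k) :
    traceFun p e (f + g) = traceFun p e f + traceFun p e g := by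
  ext m
  simp only [coeff_traceFun, MvPolynomial.coeff_add, map_add]

theorem traceFun_pow_mul (e : ℕ) (r f : MvPolynomial (Fin n) k) :
    traceFun p e (r ^ (p ^ e) * f) = r * traceFun p e f := by
  induction r using MvPolynomial.induction_on' with
  | monomial u a =>
    ext m
    have hq : 0 < p ^ e := expChar_pow_pos k p e
    rw [coeff_traceFun, MvPolynomial.monomial_pow, MvPolynomial.coeff_monomial_mul',
      MvPolynomial.coeff_monomial_mul', coeff_traceFun]
    have hle : p ^ e • u ≤ traceExponent p e m ↔ u ≤ m := by
      refine forall_congr' fun i => ?_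
      rw [traceExponent_apply, Finsupp.smul_apply, smul_eq_mul]
      constructor
      · intro h
        by_contra hlt
        have h1 : p ^ e * (m i + 1) ≤ p ^ e * u i := Nat.mul_le_mul_left _ (by omega)
        rw [mul_add] at h1
        omega
      · intro h
        exact le_add_right (Nat.mul_le_mul_left _ h)
    by_cases h : u ≤ m
    · rw [if_pos h, if_pos (hle.2 h), map_mul]
      congr 1
      · rw [RingEquiv.symm_apply_eq, iterateFrobeniusEquiv_def]
      · congr 2
        ext i
        have hi : p ^ e * u i ≤ p ^ e * m i := Nat.mul_le_mul_left _ (h i)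
        simp only [traceExponent_apply, Finsupp.tsub_apply, Finsupp.smul_apply, smul_eq_mul,
          Nat.mul_sub]
        omega
    · rw [if_neg h, if_neg (fun h' => h (hle.1 h')), map_zero]
  | add r s hr hs =>
    rw [add_pow_expChar_pow, add_mul, traceFun_add, hr, hs, add_mul]

/-- The generator `Φ_S` of `Hom_S(F^e_* S, S)` for `S = k[x_1, …, x_n]`: the `S`-linear map that
sends `F^e_* (x_1 ⋯ x_n)^(p^e - 1)` to `1` and the other monomials `F^e_* x^l`,
`0 ≤ l_i < p^e`, to `0`. -/
noncomputable def frobTrace (k : Type u) [Field k] (p : ℕ) [ExpChar k p] [PerfectRing k p]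
    (n e : ℕ) : FPush (MvPolynomial (Fin n) k) p e →ₗ[MvPolynomial (Fin n) k]
      MvPolynomial (Fin n) k where
  toFun y := traceFun p e ((toF _ p e).symm y)
  map_add' x y := by rw [map_add, traceFun_add]
  map_smul' r y := traceFun_pow_mul e r _

/-- The values of `Φ_S` on the monomial basis of `F^e_* S`, which determine it. -/
theorem frobTrace_basis (e : ℕ) (l : Fin n →₀ ℕ) (hl : ∀ i, l i < p ^ e) :
    frobTrace k p n e (toF _ p e (MvPolynomial.monomial l 1)) =
      if ∀ i, l i = p ^ e - 1 then 1 else 0 := by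
  have hq : 0 < p ^ e := expChar_pow_pos k p e
  change traceFun p e (MvPolynomial.monomial l (1 : k)) = _
  ext m
  rw [coeff_traceFun, MvPolynomial.coeff_monomial]
  by_cases h : l = traceExponent p e m
  · have hm : m = 0 := by
      ext i
      have h1 := hl i
      rw [h, traceExponent_apply] at h1
      by_contra h0
      have h2 : p ^ e * 1 ≤ p ^ e * m i :=
        Nat.mul_le_mul_left _ (Nat.one_le_iff_ne_zero.2 h0)
      omega
    have h3 : ∀ i, l i = p ^ e - 1 := by
      intro i
      rw [h, traceExponent_apply, hm]
      simp
    rw [if_pos h, if_pos h3, hm, map_one, MvPolynomial.coeff_zero_one]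
  · rw [if_neg h, map_zero]
    by_cases h3 : ∀ i, l i = p ^ e - 1
    · rw [if_pos h3, MvPolynomial.coeff_one, if_neg]
      rintro rfl
      refine h (Finsupp.ext fun i => ?_)
      rw [h3 i, traceExponent_apply]
      simp
    · rw [if_neg h3, MvPolynomial.coeff_zero]

end Polynomial

end FrobeniusAlg

namespace FrobeniusAlg

open IsLocalRing RingTheory.Sequence
open scoped Pointwise

universe u v

/-! ### Regular local rings: regular sequences, their powers, and freeness. -/

section Regular

/-! Write `q = p ^ e` and `Φ` for the trace. As `φ` is surjective, `a ⊆ φ(F^e_* a)` for every ideal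
`a`, so the chain starting at `JB + Q` ascends and stops at a compatible ideal `C`. Compatible
ideals are radical and their minimal primes are compatible. It remains to place `JB + Q`: it is not
inside `Q`, but it is inside every compatible prime `P` that properly contains `Q`. Then `C ⊆ P`,
each minimal prime of `C` is strictly larger than `Q`, and Noetherian induction gives termination
and completeness.

Not inside `Q` (`not_idealB_le`): over `K = Frac(S/Q)` the space `Hom_K(F^e_* K, K)` is
one-dimensional over `F^e_* K`, and `z` induces a nonzero element of it. So each `w` in `Q^[q] : Q`
is, up to a factor outside `Q`, a multiple of `z` modulo `Q^[q]`.

Inside `P` (`idealB_le`): suppose `J` is not inside `P`. Then `(S/Q)_P` is regular and not a field,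
so its Frobenius pushforward is free (the easy half of Kunz's theorem, `free_FPush`) and some linear
map carries an element of the maximal ideal to a unit. Clearing denominators turns it into `Φ(w · )`
with `w` in `Q^[q] : Q` and `Φ(w y) ∉ P` for some `y ∈ P`. For `b ∈ B` one has `b w ∈ ⟨z⟩ + Q^[q]`,
hence `b Φ(w y) = Φ(b^q w y) ∈ P` and `b ∈ P`. -/

theorem isWeaklyRegular_of_subsingleton {R : Type u} [CommRing R] (M : Type v) [AddCommGroup M]
    [Module R M] [Subsingleton M] (rs : List R) : IsWeaklyRegular M rs :=
  ⟨fun _ _ _ _ _ => Subsingleton.elim _ _⟩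

/-- Induction along the sequence: regularity of `r` on `M''` keeps the short exact sequence exact on
the left after reduction modulo `r`. -/
theorem isWeaklyRegular_of_exact {R : Type u} [CommRing R] (rs : List R) :
    ∀ {M M' M'' : Type v} [AddCommGroup M] [AddCommGroup M'] [AddCommGroup M'']
      [Module R M] [Module R M'] [Module R M''] (f : M' →ₗ[R] M) (g : M →ₗ[R] M''),
      Function.Injective f → Function.Exact f g → Function.Surjective g →
      IsWeaklyRegular M' rs → IsWeaklyRegular M'' rs → IsWeaklyRegular M rs := by
  induction rs with
  | nil => intros; exact .nil R _
  | cons r rs ih =>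
    intro M M' M'' _ _ _ _ _ _ f g hf hfg hg h' h''
    rw [isWeaklyRegular_cons_iff] at h' h'' ⊢
    refine ⟨isSMulRegular_of_range_eq_ker hf hfg.linearMap_ker_eq.symm h'.1 h''.1,
      ih (QuotSMulTop.map r f) (QuotSMulTop.map r g) ?_ (QuotSMulTop.map_exact r hfg hg)
        (QuotSMulTop.map_surjective r hg) h'.2 h''.2⟩
    have h0 : Function.Exact (0 : PUnit.{v+1} →ₗ[R] M') f :=
      (LinearMap.exact_zero_iff_injective _ _).2 hf
    have h1 := QuotSMulTop.map_first_exact_on_four_term_exact_of_isSMulRegular_last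
      (r := r) h0 hfg h''.1
    rw [map_zero] at h1
    exact (LinearMap.exact_zero_iff_injective _ _).1 h1

/-- `M/x^(a+1)M` is an extension of `M/xM` by `M/x^a M`, embedded through multiplication by `x`. -/
theorem isWeaklyRegular_quotSMulTop_pow {R : Type u} [CommRing R] {M : Type v} [AddCommGroup M]
    [Module R M] {x : R} {rs : List R} (hx : IsSMulRegular M x)
    (h : IsWeaklyRegular (QuotSMulTop x M) rs) (a : ℕ) :
    IsWeaklyRegular (QuotSMulTop (x ^ a) M) rs := by
  induction a with
  | zero =>
    have : Subsingleton (QuotSMulTop (x ^ 0) M) := by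
      rw [Submodule.Quotient.subsingleton_iff, pow_zero, one_smul]
    exact isWeaklyRegular_of_subsingleton _ _
  | succ a ih =>
    let f : QuotSMulTop (x ^ a) M →ₗ[R] QuotSMulTop (x ^ (a + 1)) M :=
      Submodule.mapQ _ _ (LinearMap.lsmul R M x) (by
        intro y hy
        obtain ⟨w, -, rfl⟩ := (Submodule.mem_smul_pointwise_iff_exists _ _ _).1 hy
        refine (Submodule.mem_smul_pointwise_iff_exists _ _ _).2 ⟨w, trivial, ?_⟩
        exact (by rw [pow_succ', mul_smul] : x ^ (a + 1) • w = x • x ^ a • w))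
    let g : QuotSMulTop (x ^ (a + 1)) M →ₗ[R] QuotSMulTop x M :=
      Submodule.factor (by
        intro y hy
        obtain ⟨w, -, rfl⟩ := (Submodule.mem_smul_pointwise_iff_exists _ _ _).1 hy
        refine (Submodule.mem_smul_pointwise_iff_exists _ _ _).2 ⟨x ^ a • w, trivial, ?_⟩
        rw [pow_succ', mul_smul])
    refine isWeaklyRegular_of_exact rs f g ?_ ?_ (Submodule.factor_surjective _) ih h
    · refine (injective_iff_map_eq_zero f).2 fun y hy => ?_
      induction y using Submodule.Quotient.induction_on with
      | H y =>
        have h1 : x • y ∈ x ^ (a + 1) • (⊤ : Submodule R M) :=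
          (Submodule.Quotient.mk_eq_zero _).1 hy
        obtain ⟨w, -, hw⟩ := (Submodule.mem_smul_pointwise_iff_exists _ _ _).1 h1
        refine (Submodule.Quotient.mk_eq_zero _).2
          ((Submodule.mem_smul_pointwise_iff_exists _ _ _).2 ⟨w, trivial, ?_⟩)
        apply hx
        simpa [pow_succ', mul_smul] using hw
    · intro y
      induction y using Submodule.Quotient.induction_on with
      | H y =>
        constructor
        · intro hy
          have h1 : y ∈ x • (⊤ : Submodule R M) := (Submodule.Quotient.mk_eq_zero _).1 hy
          obtain ⟨w, -, hw⟩ := (Submodule.mem_smul_pointwise_iff_exists _ _ _).1 h1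
          exact ⟨Submodule.Quotient.mk w, congrArg Submodule.Quotient.mk hw⟩
        · rintro ⟨w, hw⟩
          induction w using Submodule.Quotient.induction_on with
          | H w =>
            rw [← hw]
            exact (Submodule.Quotient.mk_eq_zero _).2
              ((Submodule.mem_smul_pointwise_iff_exists _ _ _).2 ⟨w, trivial, rfl⟩)

theorem isWeaklyRegular_map_pow {R : Type u} [CommRing R] (a : ℕ) (rs : List R) :
    ∀ {M : Type v} [AddCommGroup M] [Module R M], IsWeaklyRegular M rs →
      IsWeaklyRegular M (rs.map (· ^ a)) := by
  induction rs with
  | nil => intros; exact .nil R _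
  | cons r rs ih =>
    intro M _ _ h
    rw [isWeaklyRegular_cons_iff] at h
    rw [List.map_cons, isWeaklyRegular_cons_iff]
    exact ⟨h.1.pow a, ih (isWeaklyRegular_quotSMulTop_pow h.1 h.2 a)⟩

theorem isLocalRing_quotient_span_singleton {R : Type u} [CommRing R] [IsLocalRing R] {x : R}
    (hx : x ∈ maximalIdeal R) : IsLocalRing (R ⧸ Ideal.span {x}) := by
  have : Nontrivial (R ⧸ Ideal.span {x}) := Ideal.Quotient.nontrivial_iff.2 fun h =>
    (maximalIdeal.isMaximal R).ne_top
      (top_le_iff.1 (h ▸ (Ideal.span_singleton_le_iff_mem _).2 hx))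
  exact IsLocalRing.of_surjective' _ Ideal.Quotient.mk_surjective

theorem maximalIdeal_quotient_span_singleton_of_ofList_cons {R : Type u} [CommRing R]
    [IsLocalRing R] {x : R} {xs : List R} [IsLocalRing (R ⧸ Ideal.span {x})]
    (h : Ideal.ofList (x :: xs) = maximalIdeal R) :
    Ideal.ofList (xs.map (Ideal.Quotient.mk (Ideal.span {x}))) =
      maximalIdeal (R ⧸ Ideal.span {x}) := by
  rw [← map_maximalIdeal_of_surjective _ Ideal.Quotient.mk_surjective, ← h, Ideal.map_ofList,
    List.map_cons, Ideal.ofList_cons, Ideal.Quotient.mk_singleton_self, Ideal.span_singleton_zero,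
    bot_sup_eq]

theorem mem_maximalIdeal_of_ofList_cons {R : Type u} [CommRing R]
    [IsLocalRing R] {x : R} {xs : List R} (h : Ideal.ofList (x :: xs) = maximalIdeal R) :
    x ∈ maximalIdeal R :=
  h ▸ Ideal.subset_span (List.mem_cons_self ..)

/-- Freeness lifts from `M/xM` over `R/x` when `x` is regular on `M`; after all the generators of
the maximal ideal are killed, the base is a field. -/
theorem free_of_isWeaklyRegular (n : ℕ) : ∀ {R : Type u} [CommRing R] [IsLocalRing R]
    [IsNoetherianRing R] {M : Type v} [AddCommGroup M] [Module R M] [Module.Finite R M]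
    (xs : List R), xs.length = n → Ideal.ofList xs = maximalIdeal R →
      IsWeaklyRegular M xs → Module.Free R M := by
  induction n with
  | zero =>
    intro R _ _ _ M _ _ _ xs hn hm _
    rw [List.length_eq_zero_iff.1 hn, Ideal.ofList_nil] at hm
    let _ := (isField_iff_maximalIdeal_eq.2 hm.symm).toField
    exact Module.Free.of_divisionRing R M
  | succ n ih =>
    intro R _ _ _ M _ _ _ xs hn hm hreg
    obtain ⟨x, xs, rfl⟩ := List.exists_cons_of_length_eq_add_one hn
    have hx := mem_maximalIdeal_of_ofList_cons hm
    have := isLocalRing_quotient_span_singleton hx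
    rw [isWeaklyRegular_cons_iff'] at hreg
    have hfin : Module.Finite (R ⧸ Ideal.span {x}) (QuotSMulTop x M) :=
      Module.Finite.of_restrictScalars_finite R _ _
    have hfp := Module.finitePresentation_of_finite R M
    refine (Module.free_quotSMulTop_iff_free R M (maximalIdeal_le_jacobson _ hx) hreg.1).1
      (ih _ ?_ (maximalIdeal_quotient_span_singleton_of_ofList_cons hm) hreg.2)
    simpa using hn

/-- Exchange: since `x` lies outside the square of the maximal ideal, some generator occurs in it
with a unit coefficient, and `x` can replace that generator. -/
theorem exists_ofList_cons_eq_maximalIdeal {R : Type u} [CommRing R] [IsLocalRing R]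
    {xs : List R} {n : ℕ} (hn : xs.length = n + 1) (hm : Ideal.ofList xs = maximalIdeal R) {x : R}
    (hx : x ∈ maximalIdeal R) (hx2 : x ∉ maximalIdeal R * maximalIdeal R) :
    ∃ ys : List R, ys.length = n ∧ Ideal.ofList (x :: ys) = maximalIdeal R := by
  have hspan : Ideal.span (Set.range xs.get) = maximalIdeal R := by
    rw [← hm, Set.range_list_get]
  obtain ⟨c, hc⟩ := Ideal.mem_span_range_iff_exists_fun.1 (hspan.symm ▸ hx)
  have hmem (i) : xs.get i ∈ maximalIdeal R := hspan ▸ Ideal.subset_span ⟨i, rfl⟩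
  obtain ⟨i, hi⟩ : ∃ i, c i ∉ maximalIdeal R := by
    by_contra! h
    exact hx2 (hc ▸ Ideal.sum_mem _ fun i _ => Ideal.mul_mem_mul (h i) (hmem i))
  have hu : IsUnit (c i) := by simpa using hi
  refine ⟨xs.eraseIdx i, by
    have := i.2
    rw [List.length_eraseIdx_of_lt i.2]
    omega, le_antisymm ?_ ?_⟩
  · refine Ideal.span_le.2 fun y hy => ?_
    rcases List.mem_cons.1 hy with rfl | hy
    · exact hx
    · exact hm ▸ Ideal.subset_span (List.mem_of_mem_eraseIdx hy)
  · rw [← hspan, Ideal.span_le]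
    have hne {j} (hj : j ≠ i) : xs.get j ∈ Ideal.ofList (x :: xs.eraseIdx i) := by
      refine Ideal.subset_span (List.mem_cons_of_mem _ (List.mem_eraseIdx_iff_getElem.2 ?_))
      exact ⟨j, j.2, fun h => hj (Fin.ext h), rfl⟩
    rintro _ ⟨j, rfl⟩
    by_cases hj : j = i
    · subst hj
      refine (Ideal.unit_mul_mem_iff_mem _ hu).1 ?_
      rw [← Finset.add_sum_erase _ _ (Finset.mem_univ j)] at hc
      rw [eq_sub_of_add_eq hc]
      refine Ideal.sub_mem _ (Ideal.subset_span (List.mem_cons_self ..)) (Ideal.sum_mem _ ?_)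
      exact fun l hl => Ideal.mul_mem_left _ _ (hne (Finset.ne_of_mem_erase hl))
    · exact hne hj

theorem le_ringKrullDim_quotient_span_singleton {R : Type u} [CommRing R] [IsLocalRing R]
    [IsNoetherianRing R] {x : R} (hx : x ∈ maximalIdeal R) {n : ℕ}
    (hn : ((n + 1 : ℕ) : WithBot ℕ∞) ≤ ringKrullDim R) :
    (n : WithBot ℕ∞) ≤ ringKrullDim (R ⧸ Ideal.span {x}) := by
  have h := hn.trans (ringKrullDim_le_ringKrullDim_quotSMulTop_succ hx)
  rw [← Submodule.ideal_span_singleton_smul, smul_eq_mul, Ideal.mul_top, Nat.cast_add,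
    Nat.cast_one] at h
  exact (ENat.WithBot.add_le_add_one_right_iff).1 h

theorem exists_mem_maximalIdeal_notMem_sq_notMem_minimalPrimes {R : Type u} [CommRing R]
    [IsLocalRing R] [IsNoetherianRing R] (h : 0 < ringKrullDim R) :
    ∃ x ∈ maximalIdeal R, x ∉ maximalIdeal R * maximalIdeal R ∧ ∀ P ∈ minimalPrimes R, x ∉ P := by
  classical
  by_contra! hcon
  have hfin := minimalPrimes.finite_of_isNoetherianRing R
  have hsub : (maximalIdeal R : Set R) ⊆
      ⋃ P ∈ ((insert (maximalIdeal R * maximalIdeal R) hfin.toFinset : Finset (Ideal R)) :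
        Set (Ideal R)), (P : Set R) := by
    intro x hx
    simp only [Set.mem_iUnion]
    by_cases hx2 : x ∈ maximalIdeal R * maximalIdeal R
    · exact ⟨_, by simp, hx2⟩
    · obtain ⟨P, hP, hxP⟩ := hcon x hx hx2
      exact ⟨P, by simp [hP], hxP⟩
  -- Prime avoidance tolerates two non-prime members; both exceptional slots are given to the square
  -- of the maximal ideal. Nakayama excludes that member, positive dimension the minimal primes.
  rw [Ideal.subset_union_prime (f := fun P : Ideal R => P) (maximalIdeal R * maximalIdeal R)
    (maximalIdeal R * maximalIdeal R)] at hsub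
  · obtain ⟨P, hP, hle⟩ := hsub
    rcases Finset.mem_insert.1 hP with rfl | hP
    · have h0 : maximalIdeal R = ⊥ := Submodule.eq_bot_of_le_smul_of_le_jacobson_bot
        (maximalIdeal R) _ (IsNoetherian.noetherian _) hle (maximalIdeal_le_jacobson _)
      rw [ringKrullDim_eq_zero_of_isField (isField_iff_maximalIdeal_eq.2 h0)] at h
      exact lt_irrefl _ h
    · have hP' : P ∈ minimalPrimes R := by simpa using hP
      have := hP'.isPrime
      have hPm : P = maximalIdeal R := le_antisymm (le_maximalIdeal this.ne_top) hle
      rw [← maximalIdeal_height_eq_ringKrullDim, ← hPm, Ideal.height_eq_zero_iff.2 hP'] at h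
      exact lt_irrefl _ h
  · intro P hP hne _
    have : P ∈ minimalPrimes R := by simpa [hne] using hP
    exact this.isPrime

/-- Only the inequality with the dimension is carried, because it survives passing to `R/x`: the
dimension drops by at most one. -/
theorem isDomain_of_length_le_ringKrullDim (n : ℕ) : ∀ {R : Type u} [CommRing R] [IsLocalRing R]
    [IsNoetherianRing R] (xs : List R), xs.length = n → Ideal.ofList xs = maximalIdeal R →
      (n : WithBot ℕ∞) ≤ ringKrullDim R → IsDomain R := by
  induction n with
  | zero =>
    intro R _ _ _ xs hn hm _
    rw [List.length_eq_zero_iff.1 hn, Ideal.ofList_nil] at hm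
    exact (isField_iff_maximalIdeal_eq.2 hm.symm).isDomain
  | succ n ih =>
    intro R _ _ _ xs hn hm hdim
    obtain ⟨x, hx, hx2, hxP⟩ := exists_mem_maximalIdeal_notMem_sq_notMem_minimalPrimes
      (lt_of_lt_of_le (by exact_mod_cast n.succ_pos) hdim)
    obtain ⟨ys, hys, hym⟩ := exists_ofList_cons_eq_maximalIdeal hn hm hx hx2
    have := isLocalRing_quotient_span_singleton hx
    have hdom : IsDomain (R ⧸ Ideal.span {x}) := ih (ys.map (Ideal.Quotient.mk _)) (by simpa)
      (maximalIdeal_quotient_span_singleton_of_ofList_cons hym)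
      (le_ringKrullDim_quotient_span_singleton hx hdim)
    have hprime : (Ideal.span {x}).IsPrime := (Ideal.Quotient.isDomain_iff_prime _).1 hdom
    obtain ⟨P, hP, hPx⟩ := Ideal.exists_minimalPrimes_le (J := Ideal.span {x}) (bot_le)
    have hPp : P.IsPrime := hP.isPrime
    have hxP := hxP P hP
    -- `(x)` is prime and contains `P`, while `x ∉ P`; hence `P = xP`, and Nakayama applies.
    have hP0 : P = ⊥ := by
      refine Submodule.eq_bot_of_le_smul_of_le_jacobson_bot (maximalIdeal R) P
        (IsNoetherian.noetherian _) (fun y hy => ?_) (maximalIdeal_le_jacobson _)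
      obtain ⟨r, rfl⟩ := Ideal.mem_span_singleton'.1 (hPx hy)
      rw [mul_comm]
      exact Ideal.mul_mem_mul hx ((hPp.mem_or_mem hy).resolve_right hxP)
    rw [hP0] at hPp
    exact IsDomain.of_bot_isPrime R

theorem isWeaklyRegular_of_length_le_ringKrullDim (n : ℕ) : ∀ {R : Type u} [CommRing R]
    [IsLocalRing R] [IsNoetherianRing R] (xs : List R), xs.length = n →
      Ideal.ofList xs = maximalIdeal R → (n : WithBot ℕ∞) ≤ ringKrullDim R →
      IsWeaklyRegular R xs := by
  induction n with
  | zero =>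
    intro R _ _ _ xs hn _ _
    rw [List.length_eq_zero_iff.1 hn]
    exact .nil R _
  | succ n ih =>
    intro R _ _ _ xs hn hm hdim
    have hdom := isDomain_of_length_le_ringKrullDim _ xs hn hm hdim
    obtain ⟨x, xs, rfl⟩ := List.exists_cons_of_length_eq_add_one hn
    have hx := mem_maximalIdeal_of_ofList_cons hm
    have := isLocalRing_quotient_span_singleton hx
    have hxs : xs.length = n := by simpa using hn
    rw [isWeaklyRegular_cons_iff]
    constructor
    · have hx0 : x ≠ 0 := by
        rintro rfl
        have hm' : Ideal.ofList xs = maximalIdeal R := by simpa [Ideal.ofList_cons] using hm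
        have h1 := (hdim.trans (ringKrullDim_le_spanFinrank_maximalIdeal R))
        have h2 : (maximalIdeal R).spanFinrank ≤ n := by
          classical
          have h3 := Submodule.spanFinrank_span_le_ncard_of_finite (R := R) xs.toFinset.finite_toSet
          rw [Set.ncard_coe_finset] at h3
          have h4 : Submodule.span R (xs.toFinset : Set R) = maximalIdeal R := by
            rw [← hm', List.coe_toFinset]
          rw [h4] at h3
          exact h3.trans (xs.toFinset_card_le.trans hxs.le)
        have h5 : n + 1 ≤ (maximalIdeal R).spanFinrank := by exact_mod_cast h1
        omega
      exact IsSMulRegular.of_ne_zero hx0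
    · have h1 := ih (xs.map (Ideal.Quotient.mk (Ideal.span {x}))) (by simpa)
        (maximalIdeal_quotient_span_singleton_of_ofList_cons hm)
        (le_ringKrullDim_quotient_span_singleton hx hdim)
      have h2 : IsWeaklyRegular (R ⧸ Ideal.span {x}) xs :=
        (isWeaklyRegular_map_algebraMap_iff (S := R ⧸ Ideal.span {x}) _ _).1 h1
      have h3 : Ideal.span {x} = x • (⊤ : Ideal R) := by
        rw [← Submodule.ideal_span_singleton_smul, smul_eq_mul, Ideal.mul_top]
      exact ((Submodule.quotEquivOfEq _ _ h3).isWeaklyRegular_congr xs).1 h2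

theorem exists_ofList_eq_maximalIdeal (R : Type u) [CommRing R] [h : IsRegularLocalRing R] :
    ∃ xs : List R, Ideal.ofList xs = maximalIdeal R ∧
      (xs.length : WithBot ℕ∞) ≤ ringKrullDim R := by
  obtain ⟨s, hs, hspan⟩ := Submodule.FG.exists_span_finset_card_eq_spanFinrank
    (IsNoetherian.noetherian (maximalIdeal R))
  refine ⟨s.toList, ?_, ?_⟩
  · rw [← hspan]
    simp [Ideal.ofList, Ideal.span]
  · rw [Finset.length_toList, hs, h.spanFinrank_maximalIdeal]

end Regular

end FrobeniusAlg

namespace FrobeniusAlg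

open IsLocalRing RingTheory.Sequence

universe u v

/-! ### Frobenius pushforward of a regular local ring. -/

section FrobeniusRegular

variable {R : Type u} [CommRing R] {p : ℕ} [ExpChar R p] {e : ℕ}

/-- `x` acts on `F^e_* R` as `x^q` acts on `R`, and the `q`-th powers of a regular system of
parameters still form a regular sequence. -/
theorem free_FPush [IsRegularLocalRing R] [Module.Finite R (FPush R p e)] :
    Module.Free R (FPush R p e) := by
  obtain ⟨xs, hm, hlen⟩ := exists_ofList_eq_maximalIdeal R
  have h1 := isWeaklyRegular_map_pow (p ^ e) xs
    (isWeaklyRegular_of_length_le_ringKrullDim _ xs rfl hm hlen)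
  refine free_of_isWeaklyRegular _ xs rfl hm
    (((toF R p e).isWeaklyRegular_congr (List.forall₂_map_left_iff.2 ?_)).1 h1)
  exact List.forall₂_same.2 fun r _ x => (smul_toF r x).symm

/-- Pick `x` in the maximal ideal but not in its square. If all coordinates of `F^e_* x` in a basis
were non-units, `x` would be a combination of their `q`-th powers, hence in the square as `q ≥ 2`.
-/
theorem exists_linearMap_FPush_notMem_maximalIdeal [IsRegularLocalRing R]
    [Module.Finite R (FPush R p e)] (hq : 1 < p ^ e) (h : maximalIdeal R ≠ ⊥) :
    ∃ (ψ : FPush R p e →ₗ[R] R), ∃ x ∈ maximalIdeal R, ψ (toF R p e x) ∉ maximalIdeal R := by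
  obtain ⟨x, hx, hx2⟩ : ∃ x ∈ maximalIdeal R, x ∉ maximalIdeal R * maximalIdeal R := by
    by_contra! hcon
    exact h (Submodule.eq_bot_of_le_smul_of_le_jacobson_bot (maximalIdeal R) _
      (IsNoetherian.noetherian _) hcon (maximalIdeal_le_jacobson _))
  have hfree : Module.Free R (FPush R p e) := free_FPush
  let b := Module.Free.chooseBasis R (FPush R p e)
  by_contra! hcon
  have hsum : x = ∑ i, (b.repr (toF R p e x) i) ^ (p ^ e) * (toF R p e).symm (b i) := by
    have h1 := congrArg (toF R p e).symm (b.sum_repr (toF R p e x))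
    rw [map_sum] at h1
    exact h1.symm
  refine hx2 (hsum ▸ Ideal.sum_mem _ fun i _ => Ideal.mul_mem_right _ _ ?_)
  have h1 : b.repr (toF R p e x) i ∈ maximalIdeal R := hcon (b.coord i) x hx
  rw [← pow_two]
  exact Ideal.pow_le_pow_right hq (Ideal.pow_mem_pow h1 _)

end FrobeniusRegular

/-! ### Maps `F^e_* K → K` over a field, and their construction from a subring. -/

section FieldDuality

variable {K : Type u} [Field K] {p : ℕ} [ExpChar K p] {e : ℕ}

/-- The map `F^e_* y ↦ ψ (F^e_* (y · ))`. -/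
noncomputable def mulDual (ψ : FPush K p e →ₗ[K] K) :
    FPush K p e →ₗ[K] (FPush K p e →ₗ[K] K) :=
  LinearMap.mk₂ K (fun y x => ψ (toF K p e ((toF K p e).symm y * (toF K p e).symm x)))
    (fun y y' x => by rw [map_add, add_mul, map_add, map_add])
    (fun c y x => by
      rw [← map_smul, smul_toF]
      exact congrArg (fun t => ψ (toF K p e t)) (mul_assoc _ _ _))
    (fun y x x' => by rw [map_add, mul_add, map_add, map_add])
    (fun c y x => by
      rw [← map_smul, smul_toF]
      exact congrArg (fun t => ψ (toF K p e t)) (mul_left_comm _ _ _))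

/-- `mulDual ψ` is injective because nonzero elements of `K` are invertible, hence bijective by
equality of dimensions. -/
theorem exists_eq_mul_of_ne_zero [Module.Finite K (FPush K p e)] (ψ χ : FPush K p e →ₗ[K] K)
    (hψ : ψ ≠ 0) : ∃ y : K, ∀ x : K, χ (toF K p e x) = ψ (toF K p e (y * x)) := by
  have hinj : Function.Injective (mulDual ψ) := by
    refine (injective_iff_map_eq_zero _).2 fun y hy => ?_
    by_contra hy0
    have hy0' : (toF K p e).symm y ≠ 0 := fun h => hy0 ((toF K p e).symm.injective h)
    refine hψ (LinearMap.ext fun x => ?_)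
    have h1 := LinearMap.congr_fun hy (toF K p e (((toF K p e).symm y)⁻¹ * (toF K p e).symm x))
    change ψ (toF K p e ((toF K p e).symm y * (((toF K p e).symm y)⁻¹ * (toF K p e).symm x))) = 0
      at h1
    rwa [mul_inv_cancel_left₀ hy0', AddEquiv.apply_symm_apply] at h1
  have hsurj := (LinearMap.injective_iff_surjective_of_finrank_eq_finrank
    (Subspace.dual_finrank_eq (K := K) (V := FPush K p e)).symm).1 hinj
  obtain ⟨y, hy⟩ := hsurj χ
  exact ⟨(toF K p e).symm y, fun x => (LinearMap.congr_fun hy (toF K p e x)).symm⟩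

end FieldDuality

section Extension

variable {S : Type u} [CommRing S] {K : Type v} [Field K] {p : ℕ} [ExpChar K p] {e : ℕ}

/-- Since `a/s = a s^(q-1) / s^q`, linearity forces the value `l(a s^(q-1)) / g(s)` at this
fraction; `key` shows that it does not depend on the representation. -/
theorem exists_linearMap_extension (g : S →+* K)
    (hg : ∀ y : K, ∃ a s : S, g s ≠ 0 ∧ y * g s = g a) (l : S →+ K)
    (hl : ∀ a y : S, l (a ^ (p ^ e) * y) = g a * l y) (hker : ∀ y, g y = 0 → l y = 0) :
    ∃ ψ : FPush K p e →ₗ[K] K, ∀ y, ψ (toF K p e (g y)) = l y := by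
  obtain ⟨d, hd⟩ : ∃ d, p ^ e = d + 1 := ⟨p ^ e - 1, by have := expChar_pow_pos K p e; omega⟩
  choose a s hs ha using hg
  have key (y : K) (b t : S) (ht : g t ≠ 0) (hb : y * g t = g b) :
      l (a y * s y ^ d) / g (s y) = l (b * t ^ d) / g t := by
    rw [div_eq_div_iff (hs y) ht, mul_comm _ (g t), mul_comm _ (g (s y)), ← hl, ← hl,
      ← sub_eq_zero, ← map_sub]
    apply hker
    rw [hd]
    simp only [map_sub, map_mul, map_pow, ← ha y, ← hb]
    ring
  refine ⟨⟨⟨fun y => l (a ((toF K p e).symm y) * s ((toF K p e).symm y) ^ d) /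
    g (s ((toF K p e).symm y)), fun x y => ?_⟩, fun r y => ?_⟩, fun y => ?_⟩
  · rw [map_add]
    generalize (toF K p e).symm x = x
    generalize (toF K p e).symm y = y
    rw [key (x + y) (a x * s y + a y * s x) (s x * s y) (by simp [hs])
      (by simp only [map_add, map_mul, ← ha]; ring)]
    have h1 : (a x * s y + a y * s x) * (s x * s y) ^ d =
        s y ^ (p ^ e) * (a x * s x ^ d) + s x ^ (p ^ e) * (a y * s y ^ d) := by rw [hd]; ring
    rw [h1, map_add, hl, hl, map_mul g]
    have := hs x
    have := hs y
    field_simp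
  · change l (a (r ^ (p ^ e) * (toF K p e).symm y) * s (r ^ (p ^ e) * (toF K p e).symm y) ^ d) /
      g (s (r ^ (p ^ e) * (toF K p e).symm y)) = r * _
    dsimp only
    generalize (toF K p e).symm y = y
    rw [key (r ^ (p ^ e) * y) (a r ^ (p ^ e) * a y) (s r ^ (p ^ e) * s y) (by simp [hs])
      (by simp only [map_mul, map_pow, ← ha]; ring)]
    have h1 : a r ^ (p ^ e) * a y * (s r ^ (p ^ e) * s y) ^ d =
        (a r * s r ^ d) ^ (p ^ e) * (a y * s y ^ d) := by ring
    have hr : r = g (a r) / g (s r) := by rw [← ha, mul_div_cancel_right₀ _ (hs r)]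
    rw [h1, hl, map_mul g, map_mul g, map_pow g, map_pow g, hd]
    conv_rhs => rw [hr]
    have := hs r
    have := hs y
    field_simp
    ring
  · change l (a (g y) * s (g y) ^ d) / g (s (g y)) = _
    rw [key (g y) y 1 (by simp) (by simp)]
    simp

end Extension

/-! ### The trace on the polynomial ring: dual bases and Fedder's colon ideals. -/

section Trace

variable {k : Type u} [Field k] {p : ℕ} [ExpChar k p] [PerfectRing k p] {n : ℕ} {e : ℕ}

open MvPolynomial

/-- The monomial `x^l`, for exponents `0 ≤ l_i < p^e`. -/
noncomputable def lowMonomial (k : Type u) [Field k] (l : Fin n → Fin (p ^ e)) :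
    MvPolynomial (Fin n) k :=
  monomial (Finsupp.equivFunOnFinite.symm fun i => (l i : ℕ)) 1

/-- The monomial `x^(p^e - 1 - l)`, for exponents `0 ≤ l_i < p^e`. -/
noncomputable def dualMonomial (k : Type u) [Field k] (l : Fin n → Fin (p ^ e)) :
    MvPolynomial (Fin n) k :=
  monomial (Finsupp.equivFunOnFinite.symm fun i => p ^ e - 1 - (l i : ℕ)) 1

theorem traceFun_dualMonomial_mul_lowMonomial (l m : Fin n → Fin (p ^ e)) :
    traceFun p e (dualMonomial k l * lowMonomial k m) = if l = m then 1 else 0 := by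
  ext t
  rw [coeff_traceFun, dualMonomial, lowMonomial, monomial_mul, one_mul, coeff_monomial]
  by_cases h : l = m
  · subst h
    rw [if_pos rfl, coeff_one]
    by_cases ht : 0 = t
    · subst ht
      rw [if_pos, if_pos rfl, map_one]
      ext i
      have := (l i).2
      simp only [traceExponent_apply, Finsupp.add_apply, Finsupp.equivFunOnFinite_symm_apply_apply,
        Finsupp.zero_apply]
      omega
    · rw [if_neg, if_neg ht, map_zero]
      refine fun h => ht (Finsupp.ext fun i => ?_)
      have h1 := DFunLike.congr_fun h i
      have := (l i).2
      simp only [traceExponent_apply, Finsupp.add_apply,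
        Finsupp.equivFunOnFinite_symm_apply_apply] at h1
      by_contra h0
      have h2 : p ^ e * 1 ≤ p ^ e * t i :=
        Nat.mul_le_mul_left _ (Nat.one_le_iff_ne_zero.2 (Ne.symm h0))
      omega
  · rw [if_neg h, coeff_zero, if_neg, map_zero]
    refine fun h' => h (funext fun i => Fin.ext ?_)
    have h1 := DFunLike.congr_fun h' i
    have := (l i).2
    have := (m i).2
    simp only [traceExponent_apply, Finsupp.add_apply,
      Finsupp.equivFunOnFinite_symm_apply_apply] at h1
    rcases Nat.eq_zero_or_pos (t i) with h0 | h0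
    · rw [h0] at h1
      omega
    · have h2 : p ^ e * 1 ≤ p ^ e * t i := Nat.mul_le_mul_left _ h0
      omega

theorem traceFun_zero : traceFun p e (0 : MvPolynomial (Fin n) k) = 0 :=
  map_zero (AddMonoidHom.mk' (traceFun p e) (traceFun_add e))

theorem traceFun_sum {ι : Type*} (s : Finset ι) (f : ι → MvPolynomial (Fin n) k) :
    traceFun p e (∑ i ∈ s, f i) = ∑ i ∈ s, traceFun p e (f i) :=
  map_sum (AddMonoidHom.mk' (traceFun p e) (traceFun_add e)) f s

/-- Expansion in the monomial basis of `F^e_* S`, with coordinates read off by the trace-dual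
monomials. By additivity it suffices to treat one term, whose coefficient is a `q`-th power as `k`
is perfect. -/
theorem sum_traceFun_pow_mul_lowMonomial (y : MvPolynomial (Fin n) k) :
    ∑ l : Fin n → Fin (p ^ e), traceFun p e (dualMonomial k l * y) ^ (p ^ e) * lowMonomial k l =
      y := by
  have hq : 0 < p ^ e := expChar_pow_pos k p e
  induction y using MvPolynomial.induction_on' with
  | monomial u a =>
    obtain ⟨b, rfl⟩ : ∃ b, b ^ (p ^ e) = a :=
      ⟨(iterateFrobeniusEquiv k p e).symm a, by
        rw [← iterateFrobeniusEquiv_def, RingEquiv.apply_symm_apply]⟩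
    let m : Fin n → Fin (p ^ e) := fun i => ⟨u i % p ^ e, Nat.mod_lt _ hq⟩
    have hu : monomial u (b ^ (p ^ e)) =
        monomial (Finsupp.equivFunOnFinite.symm fun i => u i / p ^ e) b ^ (p ^ e) *
          lowMonomial k m := by
      rw [monomial_pow, lowMonomial, monomial_mul, mul_one]
      congr 2
      ext i
      simp [m, Nat.div_add_mod]
    rw [hu, Finset.sum_eq_single m]
    · rw [mul_left_comm, traceFun_pow_mul, traceFun_dualMonomial_mul_lowMonomial, if_pos rfl,
        mul_one]
    · intro l _ hl
      rw [mul_left_comm, traceFun_pow_mul, traceFun_dualMonomial_mul_lowMonomial, if_neg hl,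
        mul_zero, zero_pow hq.ne', zero_mul]
    · simp
  | add f g hf hg =>
    conv_rhs => rw [← hf, ← hg]
    rw [← Finset.sum_add_distrib]
    refine Finset.sum_congr rfl fun l _ => ?_
    rw [mul_add, traceFun_add, add_pow_expChar_pow, add_mul]

theorem mem_frobPower_iff {Q : Ideal (MvPolynomial (Fin n) k)} {y : MvPolynomial (Fin n) k} :
    y ∈ frobPower p e Q ↔ ∀ f, traceFun p e (y * f) ∈ Q := by
  constructor
  · intro hy
    refine Submodule.span_induction (p := fun y _ => ∀ f, traceFun p e (y * f) ∈ Q) ?_ ?_ ?_ ?_ hy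
    · rintro _ ⟨c, hc, rfl⟩ f
      rw [iterateFrobenius_def, traceFun_pow_mul]
      exact Q.mul_mem_right _ hc
    · intro f
      rw [zero_mul, traceFun_zero]
      exact Q.zero_mem
    · intro a b _ _ ha hb f
      rw [add_mul, traceFun_add]
      exact Q.add_mem (ha f) (hb f)
    · intro r a _ ha f
      rw [smul_eq_mul, mul_comm r, mul_assoc]
      exact ha _
  · intro h
    rw [← sum_traceFun_pow_mul_lowMonomial (p := p) (e := e) y]
    refine Ideal.sum_mem _ fun l _ => Ideal.mul_mem_right _ _ ?_
    rw [← iterateFrobenius_def]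
    refine Ideal.mem_map_of_mem _ ?_
    rw [mul_comm]
    exact h _

/-- Fedder's description: these `w` are exactly those for which `Φ(w · )` descends to `S/Q`. -/
theorem mem_colon_frobPower_iff {Q : Ideal (MvPolynomial (Fin n) k)}
    {w : MvPolynomial (Fin n) k} :
    w ∈ (frobPower p e Q).colon (Q : Set (MvPolynomial (Fin n) k)) ↔
      ∀ y ∈ Q, traceFun p e (w * y) ∈ Q := by
  rw [Submodule.mem_colon]
  constructor
  · intro h y hy
    have := mem_frobPower_iff.1 (h y hy) 1
    rwa [mul_one] at this
  · intro h y hy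
    rw [smul_eq_mul, mem_frobPower_iff]
    intro f
    rw [mul_assoc]
    exact h _ (Q.mul_mem_right _ hy)

/-- Lifting: a Frobenius-inverse-linear `ψ`, once its denominators on the basis are cleared by `s`,
comes from an explicit multiplier of `Φ`, with the cleared values as coefficients on the dual basis.
-/
theorem map_traceFun_sum_pow_mul_dualMonomial {R : Type v} [CommRing R]
    (g : MvPolynomial (Fin n) k →+* R) (s : R) (ψ : MvPolynomial (Fin n) k →+ R)
    (hψ : ∀ a y, ψ (a ^ (p ^ e) * y) = g a * ψ y)
    (c : (Fin n → Fin (p ^ e)) → MvPolynomial (Fin n) k)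
    (hc : ∀ l, g (c l) = s * ψ (lowMonomial k l)) (y : MvPolynomial (Fin n) k) :
    g (traceFun p e ((∑ l, c l ^ (p ^ e) * dualMonomial k l) * y)) = s * ψ y := by
  conv_rhs => rw [← sum_traceFun_pow_mul_lowMonomial (p := p) (e := e) y]
  rw [Finset.sum_mul, traceFun_sum, map_sum, map_sum, Finset.mul_sum]
  refine Finset.sum_congr rfl fun l _ => ?_
  rw [mul_assoc, traceFun_pow_mul, map_mul, hc, hψ]
  ring

theorem finite_FPush_of_fractions {R : Type v} [CommRing R] [ExpChar R p]
    (g : MvPolynomial (Fin n) k →+* R)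
    (hg : ∀ y : R, ∃ a s, IsUnit (g s) ∧ y * g s = g a) : Module.Finite R (FPush R p e) := by
  obtain ⟨d, hd⟩ : ∃ d, p ^ e = d + 1 := ⟨p ^ e - 1, by have := expChar_pow_pos k p e; omega⟩
  refine ⟨Submodule.fg_def.2 ⟨Set.range fun l : Fin n → Fin (p ^ e) =>
    toF R p e (g (lowMonomial k l)), Set.finite_range _, ?_⟩⟩
  rw [eq_top_iff]
  have himg (f : MvPolynomial (Fin n) k) : toF R p e (g f) ∈ Submodule.span R
      (Set.range fun l : Fin n → Fin (p ^ e) => toF R p e (g (lowMonomial k l))) := by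
    rw [← sum_traceFun_pow_mul_lowMonomial (p := p) (e := e) f, map_sum, map_sum]
    refine Submodule.sum_mem _ fun l _ => ?_
    rw [map_mul, map_pow, ← smul_toF]
    exact Submodule.smul_mem _ _ (Submodule.subset_span ⟨l, rfl⟩)
  intro y _
  obtain ⟨y, rfl⟩ := (toF R p e).surjective y
  obtain ⟨a, s, ⟨u, hu⟩, ha⟩ := hg y
  -- With `y = a/s`, write `y = a s^(q-1) / s^q`, so that the denominator becomes a scalar.
  have h1 : toF R p e y = (↑u⁻¹ : R) • toF R p e (g (a * s ^ d)) := by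
    rw [smul_toF]
    congr 1
    rw [map_mul, ← ha, map_pow, ← hu, mul_assoc y, ← pow_succ', ← hd, mul_left_comm, ← mul_pow,
      Units.inv_mul, one_pow, mul_one]
  rw [h1]
  exact Submodule.smul_mem _ _ (himg _)

end Trace

end FrobeniusAlg

namespace FrobeniusAlg

open IsLocalRing

universe u

/-! ### Compatible ideals, the ascending chain, and minimal primes. -/

section Compatible

variable {R : Type u} [CommRing R] {p : ℕ} [ExpChar R p] {e : ℕ}

theorem IsCompatible.apply_mem {φ : FPush R p e →ₗ[R] R} {a : Ideal R} (ha : IsCompatible φ a)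
    {x : R} (hx : x ∈ a) : φ (toF R p e x) ∈ a :=
  ha ⟨_, hx, rfl⟩

theorem imageIdeal_powMap_zero (φ : FPush R p e →ₗ[R] R) (a : Ideal R) :
    imageIdeal (powMap φ 0) a = a := by
  ext y
  exact ⟨fun ⟨x, hx, h⟩ => h ▸ hx, fun hy => ⟨y, hy, rfl⟩⟩

theorem imageIdeal_powMap_succ (φ : FPush R p e →ₗ[R] R) (a : Ideal R) (s : ℕ) :
    imageIdeal (powMap φ (s + 1)) a = imageIdeal φ (imageIdeal (powMap φ s) a) := by
  ext y
  constructor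
  · rintro ⟨x, hx, rfl⟩
    exact ⟨powMap φ s (toF R p (s * e) x), ⟨x, hx, rfl⟩,
      (Function.iterate_succ_apply' (fun y => φ (toF R p e y)) s x).symm⟩
  · rintro ⟨_, ⟨x, hx, rfl⟩, rfl⟩
    exact ⟨x, hx, Function.iterate_succ_apply' (fun y => φ (toF R p e y)) s x⟩

theorem imageIdeal_mono (φ : FPush R p e →ₗ[R] R) {a b : Ideal R} (h : a ≤ b) :
    imageIdeal φ a ≤ imageIdeal φ b :=
  fun _ ⟨x, hx, hy⟩ => ⟨x, h hx, hy⟩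

theorem imageIdeal_powMap_le {φ : FPush R p e →ₗ[R] R} {a P : Ideal R} (hP : IsCompatible φ P)
    (h : a ≤ P) (s : ℕ) : imageIdeal (powMap φ s) a ≤ P := by
  induction s with
  | zero => rwa [imageIdeal_powMap_zero]
  | succ s ih =>
    rw [imageIdeal_powMap_succ]
    exact (imageIdeal_mono φ ih).trans hP

theorem map_pow_mul (φ : FPush R p e →ₗ[R] R) (r x : R) :
    φ (toF R p e (r ^ (p ^ e) * x)) = r * φ (toF R p e x) := by
  rw [← smul_toF, map_smul, smul_eq_mul]

/-- If `φ(F^e_* c) = 1`, then `r = φ(F^e_*(r^q c))`. -/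
theorem le_imageIdeal {φ : FPush R p e →ₗ[R] R} (hφ : Function.Surjective φ) (a : Ideal R) :
    a ≤ imageIdeal φ a := by
  intro r hr
  obtain ⟨c, hc⟩ := hφ 1
  refine ⟨toF R p e (r ^ (p ^ e) * (toF R p e).symm c), ?_, ?_⟩
  · exact a.mul_mem_right _ (a.pow_mem_of_mem hr _ (expChar_pow_pos R p e))
  · rw [map_pow_mul, AddEquiv.apply_symm_apply, hc, mul_one]

theorem monotone_imageIdeal_powMap {φ : FPush R p e →ₗ[R] R} (hφ : Function.Surjective φ)
    (a : Ideal R) : Monotone fun s => imageIdeal (powMap φ s) a :=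
  monotone_nat_of_le_succ fun s => by
    rw [imageIdeal_powMap_succ]
    exact le_imageIdeal hφ _

theorem exists_isFirstStable [IsNoetherianRing R] {φ : FPush R p e →ₗ[R] R}
    (hφ : Function.Surjective φ) (a : Ideal R) : ∃ t, IsFirstStable φ a t := by
  classical
  obtain ⟨s, hs⟩ := monotone_stabilizes_iff_noetherian.2 (inferInstance : IsNoetherian R R)
    ⟨_, monotone_imageIdeal_powMap hφ a⟩
  have h : ∃ s, imageIdeal (powMap φ s) a = imageIdeal (powMap φ (s + 1)) a :=
    ⟨s, hs (s + 1) s.le_succ⟩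
  exact ⟨Nat.find h, Nat.find_spec h, fun _ hm => Nat.find_min' h hm⟩

theorem IsFirstStable.isCompatible {φ : FPush R p e →ₗ[R] R} {a : Ideal R} {t : ℕ}
    (h : IsFirstStable φ a t) : IsCompatible φ (imageIdeal (powMap φ t) a) := by
  rw [IsCompatible, ← imageIdeal_powMap_succ]
  exact h.1.ge

theorem IsCompatible.isRadical {φ : FPush R p e →ₗ[R] R} (hφ : Function.Surjective φ)
    (hq : 1 < p ^ e) {a : Ideal R} (ha : IsCompatible φ a) : a.IsRadical := by
  have h1 (r : R) (hr : r ^ (p ^ e) ∈ a) : r ∈ a := by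
    obtain ⟨c, hc⟩ := hφ 1
    refine ha ⟨toF R p e (r ^ (p ^ e) * (toF R p e).symm c), a.mul_mem_right _ hr, ?_⟩
    rw [map_pow_mul, AddEquiv.apply_symm_apply, hc, mul_one]
  have h2 (m : ℕ) (r : R) (hr : r ^ ((p ^ e) ^ m) ∈ a) : r ∈ a := by
    induction m generalizing r with
    | zero => simpa using hr
    | succ m ih => exact h1 _ (ih _ (by rwa [← pow_mul, ← pow_succ']))
  rintro r ⟨m, hm⟩
  exact h2 m r (a.pow_mem_of_pow_mem hm (Nat.lt_pow_self hq).le)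

/-- Otherwise a prime over `a` avoids both the complement of `P` and `x`, so it lies strictly inside
`P`, against minimality. -/
theorem exists_notMem_mul_pow_mem_of_mem_minimalPrimes {a P : Ideal R}
    (hP : P ∈ a.minimalPrimes) {x : R} (hx : x ∈ P) : ∃ s ∉ P, ∃ m : ℕ, s * x ^ m ∈ a := by
  have hPp : P.IsPrime := hP.isPrime
  by_contra! hcon
  obtain ⟨P', hP', ha, hdis⟩ := a.exists_le_prime_disjoint (P.primeCompl ⊔ Submonoid.powers x) (by
    refine Set.disjoint_left.2 fun y hy hy' => ?_
    obtain ⟨s, hs, _, ⟨m, rfl⟩, rfl⟩ := Submonoid.mem_sup.1 hy'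
    exact hcon s hs m hy)
  have hle : P' ≤ P := fun y hy => by
    by_contra hyP
    exact Set.disjoint_left.1 hdis hy (Submonoid.mem_sup_left hyP)
  exact Set.disjoint_left.1 hdis (hP.2 ⟨hP', ha⟩ hle hx)
    (Submonoid.mem_sup_right (Submonoid.mem_powers x))

/-- Radicality gives `s ∉ P` with `s x ∈ a`; then `s φ(F^e_* x) = φ(F^e_*(s^q x)) ∈ a ⊆ P`. -/
theorem IsCompatible.of_mem_minimalPrimes {φ : FPush R p e →ₗ[R] R}
    (hφ : Function.Surjective φ) (hq : 1 < p ^ e) {a P : Ideal R} (ha : IsCompatible φ a)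
    (hP : P ∈ a.minimalPrimes) : IsCompatible φ P := by
  have hPp : P.IsPrime := hP.isPrime
  rintro _ ⟨x, hx, rfl⟩
  obtain ⟨x, rfl⟩ := (toF R p e).surjective x
  obtain ⟨s, hs, m, hm⟩ : ∃ s ∉ P, ∃ m, s * x ^ m ∈ a :=
    exists_notMem_mul_pow_mem_of_mem_minimalPrimes hP hx
  have h1 : s * x ∈ a := ha.isRadical hφ hq ⟨m + 1, by
    have : (s * x) ^ (m + 1) = s ^ m * x * (s * x ^ m) := by ring
    exact this ▸ a.mul_mem_left _ hm⟩
  have h2 : s ^ (p ^ e) * x ∈ a := by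
    obtain ⟨d, hd⟩ : ∃ d, p ^ e = d + 1 := ⟨p ^ e - 1, by omega⟩
    rw [hd, pow_succ, mul_assoc]
    exact a.mul_mem_left _ h1
  have h3 : s * φ (toF R p e x) ∈ a := by
    rw [← map_pow_mul]
    exact ha ⟨_, h2, rfl⟩
  exact (hPp.mem_or_mem (hP.1.2 h3)).resolve_left hs

end Compatible

/-! ### Position of the ideal `B` relative to `Q` and to larger compatible primes. -/

section Trace

variable {k : Type u} [Field k] {p : ℕ} [ExpChar k p] [PerfectRing k p] {n : ℕ} {e : ℕ}

theorem exists_notMem_mul_mem_span_sup_frobPower {Q : Ideal (MvPolynomial (Fin n) k)} [Q.IsPrime]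
    {z w : MvPolynomial (Fin n) k} (hz : ∀ y ∈ Q, traceFun p e (z * y) ∈ Q)
    (hz' : ∃ y, traceFun p e (z * y) ∉ Q) (hw : ∀ y ∈ Q, traceFun p e (w * y) ∈ Q) :
    ∃ b ∉ Q, b * w ∈ Ideal.span {z} ⊔ frobPower p e Q := by
  let K := FractionRing (MvPolynomial (Fin n) k ⧸ Q)
  let g : MvPolynomial (Fin n) k →+* K := (algebraMap _ K).comp (Ideal.Quotient.mk Q)
  have hg0 (y) : g y = 0 ↔ y ∈ Q := by
    rw [RingHom.comp_apply, FaithfulSMul.algebraMap_eq_zero_iff, Ideal.Quotient.eq_zero_iff_mem]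
  have : ExpChar K p := expChar_of_injective_ringHom (g.comp MvPolynomial.C).injective p
  have hg (y : K) : ∃ a s, g s ≠ 0 ∧ y * g s = g a := by
    obtain ⟨a, s, hs, rfl⟩ := IsFractionRing.div_surjective (A := MvPolynomial (Fin n) k ⧸ Q) y
    obtain ⟨a, rfl⟩ := Ideal.Quotient.mk_surjective a
    obtain ⟨s, rfl⟩ := Ideal.Quotient.mk_surjective s
    have h : g s ≠ 0 := by
      rw [Ne, hg0, ← Ideal.Quotient.eq_zero_iff_mem]
      exact nonZeroDivisors.ne_zero hs
    exact ⟨a, s, h, div_mul_cancel₀ _ h⟩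
  have hfin : Module.Finite K (FPush K p e) := finite_FPush_of_fractions g fun y => by
    obtain ⟨a, s, hs, h⟩ := hg y
    exact ⟨a, s, hs.isUnit, h⟩
  have hext (w) (hw : ∀ y ∈ Q, traceFun p e (w * y) ∈ Q) :
      ∃ ψ : FPush K p e →ₗ[K] K, ∀ y, ψ (toF K p e (g y)) = g (traceFun p e (w * y)) :=
    exists_linearMap_extension g hg
      (AddMonoidHom.mk' (fun y => g (traceFun p e (w * y))) fun a b => by
        rw [mul_add, traceFun_add, map_add])
      (fun a y => by
        change g (traceFun p e (w * (a ^ (p ^ e) * y))) = g a * g (traceFun p e (w * y))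
        rw [mul_left_comm, traceFun_pow_mul, map_mul])
      (fun y hy => (hg0 _).2 (hw y ((hg0 y).1 hy)))
  obtain ⟨ψ, hψ⟩ := hext z hz
  obtain ⟨χ, hχ⟩ := hext w hw
  have hψ0 : ψ ≠ 0 := by
    rintro rfl
    obtain ⟨y, hy⟩ := hz'
    exact hy ((hg0 _).1 (hψ y).symm)
  obtain ⟨y, hy⟩ := exists_eq_mul_of_ne_zero ψ χ hψ0
  obtain ⟨a, s, hs, ha⟩ := hg y
  refine ⟨s, fun h => hs ((hg0 s).2 h), ?_⟩
  -- Over `K` the map of `w` is that of `z` precomposed with multiplication by `y = a/s`. Evaluating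
  -- at `s f` clears the denominator and shows that `Φ((s w - a z) f) ∈ Q` for all `f`.
  have h1 : s * w - a * z ∈ frobPower p e Q := by
    refine mem_frobPower_iff.2 fun f => ?_
    have h2 := hy (g (s * f))
    rw [map_mul, ← mul_assoc, ha, ← map_mul, ← map_mul, hχ, hψ, ← sub_eq_zero, ← map_sub, hg0] at h2
    have h3 : w * (s * f) = (s * w - a * z) * f + z * (a * f) := by ring
    rwa [h3, traceFun_add, add_sub_cancel_right] at h2
  rw [← sub_add_cancel (s * w) (a * z)]
  exact Ideal.add_mem _ (Ideal.mem_sup_right h1)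
    (Ideal.mem_sup_left (Ideal.mul_mem_left _ _ (Ideal.mem_span_singleton_self z)))

theorem mem_idealB_iff {R : Type u} [CommRing R] [ExpChar R p] {z b : R} {Q : Ideal R} :
    b ∈ idealB p e z Q ↔ ∀ w ∈ (frobPower p e Q).colon (Q : Set R),
      b * w ∈ Ideal.span {z} ⊔ frobPower p e Q :=
  Submodule.mem_colon

/-- The colon ideal is finitely generated, so the product of the multipliers found for its
generators works for all `w`; it avoids `Q` by primality. -/
theorem not_idealB_le {Q : Ideal (MvPolynomial (Fin n) k)} [hQ : Q.IsPrime]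
    {z : MvPolynomial (Fin n) k} (hz : ∀ y ∈ Q, traceFun p e (z * y) ∈ Q)
    (hz' : ∃ y, traceFun p e (z * y) ∉ Q) : ¬ idealB p e z Q ≤ Q := by
  classical
  obtain ⟨T, hT⟩ := IsNoetherian.noetherian
    ((frobPower p e Q).colon (Q : Set (MvPolynomial (Fin n) k)))
  have hTmem {w} (hw : w ∈ T) : ∀ y ∈ Q, traceFun p e (w * y) ∈ Q :=
    mem_colon_frobPower_iff.1 (hT ▸ Submodule.subset_span hw)
  choose! b hb hbw using fun w (hw : w ∈ T) =>
    exists_notMem_mul_mem_span_sup_frobPower hz hz' (hTmem hw)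
  intro hle
  have hprod : ∏ w ∈ T, b w ∈ idealB p e z Q := by
    refine mem_idealB_iff.2 fun w hw => ?_
    rw [← hT] at hw
    refine Submodule.span_induction (p := fun w _ => (∏ w ∈ T, b w) * w ∈
      Ideal.span {z} ⊔ frobPower p e Q) ?_ ?_ ?_ ?_ hw
    · intro w hw
      rw [← Finset.prod_erase_mul T b hw, mul_assoc]
      exact Ideal.mul_mem_left _ _ (hbw w hw)
    · simp
    · intro x y _ _ hx hy
      rw [mul_add]
      exact Ideal.add_mem _ hx hy
    · intro r x _ hx
      rw [smul_eq_mul, mul_left_comm]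
      exact Ideal.mul_mem_left _ _ hx
  obtain ⟨w, hw, hbQ⟩ := (hQ.prod_mem_iff).1 (hle hprod)
  exact hb w hw hbQ

theorem exists_mem_colon_traceFun_notMem {Q P J : Ideal (MvPolynomial (Fin n) k)} [Q.IsPrime]
    [hP : P.IsPrime] (hq : 1 < p ^ e) (hQP : Q < P) (hJ : HasRegularNonemptyComplement Q J)
    (hJP : ¬ J ≤ P) :
    ∃ w ∈ (frobPower p e Q).colon (Q : Set (MvPolynomial (Fin n) k)),
      ∃ y ∈ P, traceFun p e (w * y) ∉ P := by
  obtain ⟨d, hd⟩ : ∃ d, p ^ e = d + 1 := ⟨p ^ e - 1, by omega⟩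
  have hker : RingHom.ker (Ideal.Quotient.mk Q) ≤ P := by rw [Ideal.mk_ker]; exact hQP.le
  have hP' : (P.map (Ideal.Quotient.mk Q)).IsPrime :=
    Ideal.map_isPrime_of_surjective Ideal.Quotient.mk_surjective hker
  have hcomap : (P.map (Ideal.Quotient.mk Q)).comap (Ideal.Quotient.mk Q) = P := by
    rw [Ideal.comap_map_of_surjective' _ Ideal.Quotient.mk_surjective, sup_eq_left.2 hker]
  obtain ⟨R, _, _, _, _⟩ : ∃ (R : Type u) (_ : CommRing R)
      (_ : Algebra (MvPolynomial (Fin n) k ⧸ Q) R),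
      IsLocalization.AtPrime R (P.map (Ideal.Quotient.mk Q)) ∧ IsRegularLocalRing R := by
    refine ⟨Localization.AtPrime (P.map (Ideal.Quotient.mk Q)), inferInstance, inferInstance,
      inferInstance, hJ.2 ⟨_, hP'⟩ fun h => hJP ?_⟩
    have h1 : J.map (Ideal.Quotient.mk Q) ≤ P.map (Ideal.Quotient.mk Q) := h
    rwa [Ideal.map_le_iff_le_comap, hcomap] at h1
  let g : MvPolynomial (Fin n) k →+* R := (algebraMap _ R).comp (Ideal.Quotient.mk Q)
  have hgP (y) : g y ∈ maximalIdeal R ↔ y ∈ P := by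
    rw [RingHom.comp_apply, IsLocalization.AtPrime.to_map_mem_maximal_iff R
      (P.map (Ideal.Quotient.mk Q)), ← Ideal.mem_comap, hcomap]
  have hinj : Function.Injective (algebraMap (MvPolynomial (Fin n) k ⧸ Q) R) :=
    IsLocalization.injective R (P.map (Ideal.Quotient.mk Q)).primeCompl_le_nonZeroDivisors
  have hg0 (y) : g y = 0 ↔ y ∈ Q := by
    rw [RingHom.comp_apply, map_eq_zero_iff _ hinj, Ideal.Quotient.eq_zero_iff_mem]
  have : ExpChar R p := expChar_of_injective_ringHom (g.comp MvPolynomial.C).injective p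
  have hg (y : R) : ∃ a s, IsUnit (g s) ∧ y * g s = g a := by
    obtain ⟨⟨a, s⟩, h⟩ := IsLocalization.surj (P.map (Ideal.Quotient.mk Q)).primeCompl y
    obtain ⟨a, rfl⟩ := Ideal.Quotient.mk_surjective a
    obtain ⟨s', hs'⟩ := Ideal.Quotient.mk_surjective s.1
    refine ⟨a, s', ?_, ?_⟩
    · rw [RingHom.comp_apply, hs']
      exact IsLocalization.map_units R s
    · rw [RingHom.comp_apply, hs']
      exact h
  have hfin : Module.Finite R (FPush R p e) := finite_FPush_of_fractions g hg
  have hm : maximalIdeal R ≠ ⊥ := by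
    obtain ⟨y, hyP, hyQ⟩ := SetLike.exists_of_lt hQP
    intro h
    have h1 := (hgP y).2 hyP
    rw [h] at h1
    exact hyQ ((hg0 y).1 h1)
  obtain ⟨ψ, x, hx, hψx⟩ := exists_linearMap_FPush_notMem_maximalIdeal (p := p) (e := e) hq hm
  obtain ⟨a, t, ht, hat⟩ := hg x
  let ψ' : MvPolynomial (Fin n) k →+ R :=
    AddMonoidHom.mk' (fun y => ψ (toF R p e (g y))) fun a b => by rw [map_add, map_add, map_add]
  -- One common denominator for the finitely many values of `ψ` on basis monomials; it is a unit in
  -- `R`, so it does not affect membership in the maximal ideal.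
  obtain ⟨s, hs⟩ := IsLocalization.exist_integer_multiples_of_finite
    (P.map (Ideal.Quotient.mk Q)).primeCompl fun l => ψ' (lowMonomial k l)
  choose c hc using hs
  choose c' hc' using fun l => Ideal.Quotient.mk_surjective (c l)
  have htr := map_traceFun_sum_pow_mul_dualMonomial g (algebraMap _ R s.1) ψ'
    (fun a y => by
      change ψ (toF R p e (g (a ^ (p ^ e) * y))) = _
      rw [map_mul, map_pow, map_pow_mul]
      rfl) c'
    (fun l => by
      rw [RingHom.comp_apply, hc', hc, Algebra.smul_def])
  -- As `x = a/t`, the element `t^(q-1) a` maps to `t^q x`, on which `ψ` takes the value `g(t)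
  -- ψ(x)`, a unit.
  refine ⟨∑ l, c' l ^ (p ^ e) * dualMonomial k l, mem_colon_frobPower_iff.2 fun y hy => ?_,
    t ^ d * a, P.mul_mem_left _ ?_, ?_⟩
  · rw [← hg0, htr]
    change _ * ψ (toF R p e (g y)) = 0
    rw [(hg0 y).2 hy, map_zero, map_zero, mul_zero]
  · rw [← hgP, ← hat]
    exact Ideal.mul_mem_right _ _ hx
  · have h1 : ψ' (t ^ d * a) = g t * ψ (toF R p e x) := by
      change ψ (toF R p e (g (t ^ d * a))) = _
      rw [← map_pow_mul, map_mul, ← hat, map_pow, hd]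
      ring_nf
    rw [← hgP, htr, Ideal.unit_mul_mem_iff_mem _ (IsLocalization.map_units R s), h1,
      Ideal.unit_mul_mem_iff_mem _ ht]
    exact hψx

theorem idealB_le {Q P J : Ideal (MvPolynomial (Fin n) k)} [Q.IsPrime]
    [hP : P.IsPrime] (hq : 1 < p ^ e) (hQP : Q < P) (hJ : HasRegularNonemptyComplement Q J)
    (hJP : ¬ J ≤ P) {z : MvPolynomial (Fin n) k} (hz : ∀ y ∈ P, traceFun p e (z * y) ∈ P) :
    idealB p e z Q ≤ P := by
  obtain ⟨d, hd⟩ : ∃ d, p ^ e = d + 1 := ⟨p ^ e - 1, by omega⟩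
  obtain ⟨w, hw, y, hy, hwy⟩ := exists_mem_colon_traceFun_notMem hq hQP hJ hJP
  intro b hb
  obtain ⟨_, haz, v, hv, h⟩ := Submodule.mem_sup.1 (mem_idealB_iff.1 hb w hw)
  obtain ⟨a, rfl⟩ := Ideal.mem_span_singleton'.1 haz
  have h1 : b ^ (p ^ e) * (w * y) = z * (b ^ d * a * y) + v * (b ^ d * y) := by
    have : b ^ (p ^ e) * (w * y) = b ^ d * (b * w) * y := by
      rw [hd]
      ring
    rw [this, ← h]
    ring
  have h2 : b * traceFun p e (w * y) ∈ P := by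
    rw [← traceFun_pow_mul, h1, traceFun_add]
    exact P.add_mem (hz _ (P.mul_mem_left _ hy)) (hQP.le (mem_frobPower_iff.1 hv _))
  exact (hP.mem_or_mem h2).resolve_right hwy

/-- This is where non-emptiness enters: if `J ≤ Q`, the closed set is all of `Spec (R/Q)`. -/
theorem HasRegularNonemptyComplement.not_le {R : Type u} [CommRing R] {Q J : Ideal R}
    (h : HasRegularNonemptyComplement Q J) : ¬ J ≤ Q := by
  obtain ⟨⟨x, hx⟩, -⟩ := h
  intro hJ
  refine hx ?_
  have h1 : J.map (Ideal.Quotient.mk Q) = ⊥ := by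
    rw [Ideal.map_eq_bot_iff_le_ker, Ideal.mk_ker]
    exact hJ
  rw [h1]
  intro y hy
  rw [(Submodule.mem_bot _).1 hy]
  exact x.asIdeal.zero_mem

end Trace

/-! ### Correctness and termination of the recursion. -/

section Algorithm

variable {k : Type u} [Field k] {p : ℕ} [ExpChar k p] [PerfectRing k p] {n e : ℕ}
  {φ : FPush (MvPolynomial (Fin n) k) p e →ₗ[MvPolynomial (Fin n) k] MvPolynomial (Fin n) k}
  {z : MvPolynomial (Fin n) k}

theorem startIdeal_le (hq : 1 < p ^ e) (hz : ∀ f, φ (toF _ p e f) = traceFun p e (z * f))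
    {Q P J : Ideal (MvPolynomial (Fin n) k)} [Q.IsPrime] [P.IsPrime]
    (hP : IsCompatible φ P) (hQP : Q < P) (hJ : HasRegularNonemptyComplement Q J) :
    startIdeal p e z Q J ≤ P := by
  refine sup_le ?_ hQP.le
  by_cases hJP : J ≤ P
  · exact Ideal.mul_le_left.trans hJP
  · exact Ideal.mul_le_right.trans
      (idealB_le hq hQP hJ hJP fun y hy => hz y ▸ hP.apply_mem hy)

theorem not_startIdeal_le (hφ : Function.Surjective φ)
    (hz : ∀ f, φ (toF _ p e f) = traceFun p e (z * f))
    {Q J : Ideal (MvPolynomial (Fin n) k)} [hQ : Q.IsPrime]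
    (hQc : IsCompatible φ Q) (hJ : HasRegularNonemptyComplement Q J) :
    ¬ startIdeal p e z Q J ≤ Q := by
  intro h
  rcases hQ.mul_le.1 (le_sup_left.trans h) with h1 | h1
  · exact hJ.not_le h1
  · refine not_idealB_le (fun y hy => hz y ▸ hQc.apply_mem hy) ?_ h1
    obtain ⟨c, hc⟩ := hφ 1
    obtain ⟨c, rfl⟩ := (toF _ p e).surjective c
    refine ⟨c, ?_⟩
    rw [← hz, hc]
    exact hQ.one_notMem

theorem lt_of_mem_minimalPrimes (hφ : Function.Surjective φ)
    (hz : ∀ f, φ (toF _ p e f) = traceFun p e (z * f))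
    {Q J : Ideal (MvPolynomial (Fin n) k)} [Q.IsPrime]
    (hQc : IsCompatible φ Q) (hJ : HasRegularNonemptyComplement Q J) {t : ℕ}
    {Q' : Ideal (MvPolynomial (Fin n) k)}
    (hQ' : Q' ∈ (imageIdeal (powMap φ t) (startIdeal p e z Q J)).minimalPrimes) : Q < Q' := by
  have h1 : startIdeal p e z Q J ≤ Q' := by
    refine le_trans ?_ hQ'.1.2
    conv_lhs => rw [← imageIdeal_powMap_zero φ (startIdeal p e z Q J)]
    exact monotone_imageIdeal_powMap hφ _ (Nat.zero_le t)
  refine lt_of_le_of_ne (le_sup_right.trans h1) ?_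
  rintro rfl
  exact not_startIdeal_le hφ hz hQc hJ h1

theorem exists_mem_minimalPrimes_le (hq : 1 < p ^ e)
    (hz : ∀ f, φ (toF _ p e f) = traceFun p e (z * f))
    {Q P J : Ideal (MvPolynomial (Fin n) k)} [Q.IsPrime] [P.IsPrime]
    (hP : IsCompatible φ P) (hQP : Q < P) (hJ : HasRegularNonemptyComplement Q J) (t : ℕ) :
    ∃ Q' ∈ (imageIdeal (powMap φ t) (startIdeal p e z Q J)).minimalPrimes, Q' ≤ P :=
  Ideal.exists_minimalPrimes_le (imageIdeal_powMap_le hP (startIdeal_le hq hz hP hQP hJ) t)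

theorem exists_algorithmLists (hφ : Function.Surjective φ) (hq : 1 < p ^ e)
    (hz : ∀ f, φ (toF _ p e f) = traceFun p e (z * f))
    {J : Ideal (MvPolynomial (Fin n) k) → Ideal (MvPolynomial (Fin n) k)}
    (hJ : ∀ Q, Q.IsPrime → IsCompatible φ Q → HasRegularNonemptyComplement Q (J Q))
    (Q : Ideal (MvPolynomial (Fin n) k)) :
    Q.IsPrime → IsCompatible φ Q → ∃ L, AlgorithmLists φ z J Q L := by
  -- Each recursive call is at a strictly larger ideal of a Noetherian ring. Leaves of the recursion
  -- occur when `C` is the unit ideal, which has no minimal primes.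
  induction Q using WellFoundedGT.induction with
  | ind Q ih =>
    intro hQ hQc
    obtain ⟨t, ht⟩ := exists_isFirstStable hφ (startIdeal p e z Q (J Q))
    choose! L hL using fun Q'
      (hQ' : Q' ∈ (imageIdeal (powMap φ t) (startIdeal p e z Q (J Q))).minimalPrimes) =>
      ih Q' (lt_of_mem_minimalPrimes hφ hz hQc (hJ Q hQ hQc) hQ') hQ'.1.1
        (ht.isCompatible.of_mem_minimalPrimes hφ hq hQ')
    exact ⟨_, .pass Q t _ ht rfl L hL⟩

theorem AlgorithmLists.finite_and_mem_iff (hφ : Function.Surjective φ) (hq : 1 < p ^ e)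
    (hz : ∀ f, φ (toF _ p e f) = traceFun p e (z * f))
    {J : Ideal (MvPolynomial (Fin n) k) → Ideal (MvPolynomial (Fin n) k)}
    (hJ : ∀ Q, Q.IsPrime → IsCompatible φ Q → HasRegularNonemptyComplement Q (J Q))
    {Q : Ideal (MvPolynomial (Fin n) k)} {L : Set (Ideal (MvPolynomial (Fin n) k))}
    (h : AlgorithmLists φ z J Q L) : Q.IsPrime → IsCompatible φ Q →
      L.Finite ∧ ∀ P, P ∈ L ↔ P.IsPrime ∧ IsCompatible φ P ∧ Q < P := by
  induction h with
  | pass Q t C ht hC L _ ih =>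
    intro hQ hQc
    subst hC
    have hc {Q'} (hQ' : Q' ∈ (imageIdeal (powMap φ t)
        (startIdeal p e z Q (J Q))).minimalPrimes) : IsCompatible φ Q' :=
      ht.isCompatible.of_mem_minimalPrimes hφ hq hQ'
    have hlt {Q'} (hQ' : Q' ∈ (imageIdeal (powMap φ t)
        (startIdeal p e z Q (J Q))).minimalPrimes) : Q < Q' :=
      lt_of_mem_minimalPrimes hφ hz hQc (hJ Q hQ hQc) hQ'
    have hfin := Ideal.finite_minimalPrimes_of_isNoetherianRing _
      (imageIdeal (powMap φ t) (startIdeal p e z Q (J Q)))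
    refine ⟨hfin.union (hfin.biUnion fun Q' hQ' => (ih Q' hQ' hQ'.1.1 (hc hQ')).1),
      fun P => ⟨?_, ?_⟩⟩
    · rintro (hP | hP)
      · exact ⟨hP.1.1, hc hP, hlt hP⟩
      · obtain ⟨Q', hQ', hP⟩ := Set.mem_iUnion₂.1 hP
        obtain ⟨h1, h2, h3⟩ := ((ih Q' hQ' hQ'.1.1 (hc hQ')).2 P).1 hP
        exact ⟨h1, h2, (hlt hQ').trans h3⟩
    · rintro ⟨hP, hPc, hQP⟩
      -- `P` contains some minimal prime of `C`: it either equals it, and is listed in this pass, or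
      -- lies strictly above it, and is listed by that recursive call.
      obtain ⟨Q', hQ', hle⟩ := exists_mem_minimalPrimes_le hq hz hPc hQP (hJ Q hQ hQc) t
      rcases hle.eq_or_lt with rfl | hlt'
      · exact Or.inl hQ'
      · exact Or.inr (Set.mem_iUnion₂.2
          ⟨Q', hQ', ((ih Q' hQ' hQ'.1.1 (hc hQ')).2 P).2 ⟨hP, hPc, hlt'⟩⟩)

end Algorithm

end FrobeniusAlg

theorem mainTheorem1 {p : ℕ} [Fact p.Prime] {k : Type*} [Field k] [CharP k p] [PerfectRing k p]
    {n e : ℕ} (he : 0 < e)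
    (φ : FrobeniusAlg.FPush (MvPolynomial (Fin n) k) p e →ₗ[MvPolynomial (Fin n) k]
      MvPolynomial (Fin n) k)
    (hφ : Function.Surjective φ)
    (z : MvPolynomial (Fin n) k)
    (hz : ∀ f : MvPolynomial (Fin n) k,
      φ (FrobeniusAlg.toF _ p e f) = FrobeniusAlg.frobTrace k p n e (FrobeniusAlg.toF _ p e (z * f))) :
    (∀ Q : Ideal (MvPolynomial (Fin n) k), Q.IsPrime → FrobeniusAlg.IsCompatible φ Q →
      ∀ J : Ideal (MvPolynomial (Fin n) k), FrobeniusAlg.HasRegularNonemptyComplement Q J →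
        (∃ t, FrobeniusAlg.IsFirstStable φ (FrobeniusAlg.startIdeal p e z Q J) t) ∧
        ∀ (t : ℕ) (C : Ideal (MvPolynomial (Fin n) k)),
          FrobeniusAlg.IsFirstStable φ (FrobeniusAlg.startIdeal p e z Q J) t →
          C = FrobeniusAlg.imageIdeal (FrobeniusAlg.powMap φ t)
            (FrobeniusAlg.startIdeal p e z Q J) →
          ∀ P : Ideal (MvPolynomial (Fin n) k), P.IsPrime → FrobeniusAlg.IsCompatible φ P →
            Q < P → ∃ Q' ∈ C.minimalPrimes, Q' ≤ P) ∧
    (∀ J : Ideal (MvPolynomial (Fin n) k) → Ideal (MvPolynomial (Fin n) k),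
      (∀ Q : Ideal (MvPolynomial (Fin n) k), Q.IsPrime → FrobeniusAlg.IsCompatible φ Q →
        FrobeniusAlg.HasRegularNonemptyComplement Q (J Q)) →
      ∀ Q : Ideal (MvPolynomial (Fin n) k), Q.IsPrime → FrobeniusAlg.IsCompatible φ Q →
        (∃ L, FrobeniusAlg.AlgorithmLists φ z J Q L) ∧
        ∀ L, FrobeniusAlg.AlgorithmLists φ z J Q L →
          L.Finite ∧ ∀ P : Ideal (MvPolynomial (Fin n) k),
            P ∈ L ↔ P.IsPrime ∧ FrobeniusAlg.IsCompatible φ P ∧ Q < P) := by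
  have hq : 1 < p ^ e := Nat.one_lt_pow he.ne' (Fact.out : p.Prime).one_lt
  have hz' : ∀ f, φ (FrobeniusAlg.toF _ p e f) = FrobeniusAlg.traceFun p e (z * f) := hz
  refine ⟨fun Q hQ hQc J hJ => ⟨FrobeniusAlg.exists_isFirstStable hφ _, ?_⟩,
    fun J hJ Q hQ hQc => ⟨FrobeniusAlg.exists_algorithmLists hφ hq hz' hJ Q hQ hQc,
      fun L hL => hL.finite_and_mem_iff hφ hq hz' hJ hQ hQc⟩⟩
  rintro t C - rfl P hP hPc hQP
  exact FrobeniusAlg.exists_mem_minimalPrimes_le hq hz' hPc hQP hJ t
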